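/- Let $N\ge 2$. Put $\overline{1}=2$, $\overline{2}=1$, and define the Mermin–Klyshko coefficients $\gamma_{(s_1,\dots,s_N)}$, $s_i\in\{1,2\}$, by $\gamma_{(1,1)}=\gamma_{(1,2)}=\gamma_{(2,1)}=1$, $\gamma_{(2,2)}=-1$ and $$\gamma_{(s_1,\dots,s_n)}=\gamma_{(s_1,\dots,s_{n-1})}+(\delta_{s_n,1}-\delta_{s_n,2})\,\gamma_{(\overline{s_1},\dots,\overline{s_{n-1}})},\qquad 3\le n\le N .$$ For $\eta_n=(\eta_n^{(1)},\eta_n^{(2)})\in\mathbb R^2$ let $F_N^{(\gamma)}(\eta_1,\dots,\eta_N)=\sum_{s_1,\dots,s_N}\gamma_{(s_1,\dots,s_N)}\,\eta_1^{(s_1)}\cdots\eta_N^{(s_N)}$. A $2\times\cdots\times2$-setting experiment with outcome spaces $\Lambda_n^{(s)}$ ($1\le n\le N$, $s=1,2$) is a family of probability measures $P_{(s_1,\dots,s_N)}$ on $\Lambda_1^{(s_1)}\times\cdots\times\Lambda_N^{(s_N)}$. It admits an LHV model if there are a probability space $(\Omega,\nu)$ and Markov kernels $P_n^{(s)}(\cdot\mid\omega)$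 from $\Omega$ to $\Lambda_n^{(s)}$ such that $P_{(s_1,\dots,s_N)}(A_1\times\cdots\times A_N)=\int\prod_n P_n^{(s_n)}(A_n\mid\omega)\,\nu(d\omega)$ for all settings and all measurable $A_n$. For $\Lambda_n^{(s)}\subseteq\mathbb R$ bounded, $\langle\lambda_1^{(s_1)}\cdots\lambda_N^{(s_N)}\rangle$ is the expectation of the product of the outcomes under $P_{(s_1,\dots,s_N)}$. 1. $\displaystyle\max_{(\eta_1,\dots,\eta_N)\in\{-1,1\}^{2N}}\bigl|F_N^{(\gamma)}(\eta_1,\dots,\eta_N)\bigr|=2^{N-1}$. 2. For every $2\times\cdots\times2$-setting experiment with outcome sets $\Lambda_n^{(s)}\subseteq[-1,1]$ (discrete or not) that admits an LHV model, $$\Bigl|\sum_{s_1,\dots,s_N}\gamma_{(s_1,\dots,s_N)}\langle\lambda_1^{(s_1)}\cdots\lambda_N^{(s_N)}\rangle\Bigr|\le 2^{N-1}.$$ The bound is tight: if $\inf\Lambda_n^{(s)}=-1$ and $\sup\Lambda_n^{(s)}=1$ for all $n,s$, then $2^{N-1}$ is the least upper bound of the left-hand side over all experiments with these outcome sets that admit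 an LHV model. Now let $\mathcal H_1,\dots,\mathcal H_N$ be complex Hilbert spaces, possibly infinite dimensional, $\mathcal H_1\otimes\cdots\otimes\mathcal H_N$ their Hilbert space tensor product, and $\rho$ a state on it (a positive operator of trace one). For bounded operators $X_n^{(1)},X_n^{(2)}$ on $\mathcal H_n$ let $\mathcal B_1=X_1^{(1)}$ and, for $2\le n\le N$, $$\mathcal B_n=\mathcal B_{n-1}\otimes(X_n^{(1)}+X_n^{(2)})+\widetilde{\mathcal B}_{n-1}\otimes(X_n^{(1)}-X_n^{(2)}),$$ where $\widetilde{\mathcal B}_{n}$ is $\mathcal B_{n}$ with $X_k^{(1)}$ and $X_k^{(2)}$ interchanged for all $k\le n$. If $\mathrm M_n^{(s)}$ are normalized positive operator-valued (POV) measures on $\Lambda_n^{(s)}$ with values in the bounded operators on $\mathcal H_n$, the experiment performed on $\rho$ with these measurements is the one with $P_{(s_1,\dots,s_N)}(A_1\times\cdots\times A_N)=\mathrm{tr}[\rho\,(\mathrm M_1^{(s_1)}(A_1)\otimes\cdots\otimes\mathrm M_N^{(s_N)}(A_N))]$. 3. If an experiment performed on $\rho$, with outcome sets $\Lambda_n^{(s)}\subseteq[-1,1]$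 and POV measures $\mathrm M_n^{(s)}$, admits an LHV model, then for the observables $X_n^{(s)}=\int\lambda\,\mathrm M_n^{(s)}(d\lambda)$ the trace $\mathrm{tr}[\rho\,\mathcal B_N]$ exists and $|\mathrm{tr}[\rho\,\mathcal B_N]|\le 2^{N-1}$. 4. If $\rho$ admits the $2\times\cdots\times2$-setting LHV description, that is, if every $2\times\cdots\times2$-setting experiment performed on $\rho$ with POV measures admits an LHV model, then the trace $\mathrm{tr}[\rho\,\mathcal B_N]$ exists and $|\mathrm{tr}[\rho\,\mathcal B_N]|\le 2^{N-1}$ for arbitrary self-adjoint $X_n^{(s)}$ with $\|X_n^{(s)}\|\le 1$, not necessarily dichotomic. -/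

import Mathlib

open MeasureTheory ProbabilityTheory
open scoped TensorProduct

noncomputable section

/-! ### Mermin–Klyshko coefficients

The two settings at a site are the elements of `Fin 2` (`0` is the first setting, `1` the second);
`Fin.rev` interchanges them. -/

/-- The Mermin–Klyshko coefficients of `N` parties, for `N ≥ 2`: the CHSH matrix for `N = 2`, then
the recursion that appends the last party. The values for `N = 0, 1` are irrelevant. -/
def mkCoeff : (N : ℕ) → (Fin N → Fin 2) → ℝ
  | 0, _ => 0
  | 1, _ => 0
  | 2, s => if s 0 = 1 ∧ s 1 = 1 then -1 else 1
  | n + 3, s =>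
      mkCoeff (n + 2) (fun i => s i.castSucc) +
        (if s (Fin.last (n + 2)) = 0 then 1 else -1) *
          mkCoeff (n + 2) (fun i => (s i.castSucc).rev)

/-- The `N`-linear form of the vectors `η n ∈ ℝ²` with coefficients `γ`. -/
def linForm {N : ℕ} (γ : (Fin N → Fin 2) → ℝ) (η : Fin N → Fin 2 → ℝ) : ℝ :=
  ∑ s : Fin N → Fin 2, γ s * ∏ n, η n (s n)

/-! ### Correlation experiments with two settings per site and LHV models

`Λ n s` is the outcome space of the `s`-th measurement at site `n`. An experiment is a family `P` of
probability measures: `P s` is the joint distribution of the outcomes of the joint measurement with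
settings `s`. -/

/-- A local hidden variable model: one probability space `(Ω, ν)` and, for every measurement at
every site, a conditional distribution of its outcome given the hidden variable, such that each
joint distribution is the mixture of the product distributions. -/
def AdmitsLHV.{w, v} {N : ℕ} (Λ : Fin N → Fin 2 → Type v) [∀ n s, MeasurableSpace (Λ n s)]
    (P : (s : Fin N → Fin 2) → Measure ((n : Fin N) → Λ n (s n))) : Prop :=
  ∃ (Ω : Type w) (_ : MeasurableSpace Ω) (ν : Measure Ω) (K : (n : Fin N) → (s : Fin 2) →
      Kernel Ω (Λ n s)),
    IsProbabilityMeasure ν ∧ (∀ n s, IsMarkovKernel (K n s)) ∧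
    ∀ (s : Fin N → Fin 2) (A : (n : Fin N) → Set (Λ n (s n))), (∀ n, MeasurableSet (A n)) →
      P s (Set.univ.pi A) = ∫⁻ ω, ∏ n, K n (s n) ω (A n) ∂ν

/-- The full correlation function of the joint measurement with settings `s` (real outcomes). -/
def corr {N : ℕ} (Λ : Fin N → Fin 2 → Set ℝ)
    (P : (s : Fin N → Fin 2) → Measure ((n : Fin N) → Λ n (s n))) (s : Fin N → Fin 2) : ℝ :=
  ∫ x, ∏ n, (x n : ℝ) ∂(P s)

/-! ### Hilbert space tensor products -/

/-- A complex Hilbert space. -/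
structure HilbertSp.{u} where
  carrier : Type u
  [nacg : NormedAddCommGroup carrier]
  [ips : InnerProductSpace ℂ carrier]
  [complete : CompleteSpace carrier]

instance HilbertSp.instCoeSort.{u} : CoeSort HilbertSp.{u} (Type u) := ⟨HilbertSp.carrier⟩

attribute [instance] HilbertSp.nacg HilbertSp.ips HilbertSp.complete

/-- Bounded operators on a Hilbert space. -/
abbrev HilbertSp.Op.{u} (H : HilbertSp.{u}) : Type u := H →L[ℂ] H

/-- The Hilbert space tensor product: the completion of the algebraic tensor product with respect
to `⟪a ⊗ b, c ⊗ d⟫ = ⟪a, c⟫ ⟪b, d⟫`. -/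
def HilbertSp.tensor.{u} (H K : HilbertSp.{u}) : HilbertSp.{u} where
  carrier := UniformSpace.Completion (H ⊗[ℂ] K)

/-- `A ⊗ B` as a bounded operator on the Hilbert space tensor product. -/
def HilbertSp.opTensor.{u} {H K : HilbertSp.{u}} (A : H.Op) (B : K.Op) : (H.tensor K).Op :=
  (TensorProduct.mapL A B).completion

/-- `H₁ ⊗ ⋯ ⊗ H_N` (it is one-dimensional for `N = 0`). -/
def tensorSpace.{u} : (N : ℕ) → (Fin N → HilbertSp.{u}) → HilbertSp.{u}
  | 0, _ => ⟨EuclideanSpace ℂ PUnit.{u + 1}⟩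
  | 1, H => H 0
  | n + 2, H => (tensorSpace (n + 1) (fun i => H i.castSucc)).tensor (H (Fin.last (n + 1)))

/-- `A₁ ⊗ ⋯ ⊗ A_N` (it is the identity for `N = 0`). -/
def tensorOp.{u} : (N : ℕ) → (H : Fin N → HilbertSp.{u}) → ((n : Fin N) → (H n).Op) →
    (tensorSpace N H).Op
  | 0, _, _ => ContinuousLinearMap.id ℂ _
  | 1, _, A => A 0
  | n + 2, H, A =>
      HilbertSp.opTensor (tensorOp (n + 1) (fun i => H i.castSucc) (fun i => A i.castSucc))
        (A (Fin.last (n + 1)))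

/-- The Bell operator of the observables `X n s`, by recursion on the number of sites `N ≥ 1`; the
tensor factor of each new site stands last. The value for `N = 0` is irrelevant. -/
def bellOp.{u} : (N : ℕ) → (H : Fin N → HilbertSp.{u}) → ((n : Fin N) → Fin 2 → (H n).Op) →
    (tensorSpace N H).Op
  | 0, _, _ => 0
  | 1, _, X => X 0 0
  | n + 2, H, X =>
      HilbertSp.opTensor
        (bellOp (n + 1) (fun i => H i.castSucc) (fun i s => X i.castSucc s))
        (X (Fin.last (n + 1)) 0 + X (Fin.last (n + 1)) 1) +
      HilbertSp.opTensor
        (bellOp (n + 1) (fun i => H i.castSucc) (fun i s => X i.castSucc s.rev))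
        (X (Fin.last (n + 1)) 0 - X (Fin.last (n + 1)) 1)

/-! ### Traces, states, positive operator-valued measures -/

/-- `T` has the (basis-independent, unconditionally convergent) trace `z`. -/
def HasTrace.{u} {H : HilbertSp.{u}} (T : H.Op) (z : ℂ) : Prop :=
  ∀ (ι : Type u) (b : HilbertBasis ι ℂ H), HasSum (fun i => inner ℂ (b i) (T (b i))) z

/-- A quantum state: a positive operator of trace one. -/
def IsState.{u} {H : HilbertSp.{u}} (ρ : H.Op) : Prop :=
  ρ.IsPositive ∧ HasTrace ρ 1

/-- A normalized positive operator-valued measure on `Λ`; only its values on measurable sets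
matter. -/
structure POVM.{u, v} (Λ : Type v) [MeasurableSpace Λ] (H : HilbertSp.{u}) where
  toFun : Set Λ → H.Op
  isPositive : ∀ A, MeasurableSet A → (toFun A).IsPositive
  map_univ : toFun Set.univ = 1
  hasSum_iUnion : ∀ A : ℕ → Set Λ, (∀ k, MeasurableSet (A k)) →
    Pairwise (fun i j => Disjoint (A i) (A j)) →
      ∀ ψ : H, HasSum (fun k => toFun (A k) ψ) (toFun (⋃ k, A k) ψ)

namespace POVM

variable {Λ : Type*} [MeasurableSpace Λ] {H : HilbertSp}

theorem apply_empty (M : POVM Λ H) (ψ : H) : M.toFun ∅ ψ = 0 := by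
  have h := M.hasSum_iUnion (fun _ => ∅) (fun _ => MeasurableSet.empty) (fun _ _ _ => by simp) ψ
  exact (summable_const_iff (β := ℕ) _).mp h.summable

/-- The measure `A ↦ ⟪ψ, M(A) ψ⟫`. -/
def measure (M : POVM Λ H) (ψ : H) : Measure Λ :=
  Measure.ofMeasurable (fun A _ => ENNReal.ofReal (inner ℂ ψ (M.toFun A ψ)).re)
    (by simp [M.apply_empty ψ])
    (by
      intro A hA hd
      have h := M.hasSum_iUnion A hA hd ψ
      have h1 : HasSum (fun k => inner ℂ ψ (M.toFun (A k) ψ))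
          (inner ℂ ψ (M.toFun (⋃ k, A k) ψ)) := (innerSL ℂ ψ).hasSum h
      have h2 := Complex.hasSum_re h1
      rw [← h2.tsum_eq, ENNReal.ofReal_tsum_of_nonneg _ h2.summable]
      intro k
      exact (M.isPositive _ (hA k)).re_inner_nonneg_right ψ)

theorem measure_apply (M : POVM Λ H) (ψ : H) {A : Set Λ} (hA : MeasurableSet A) :
    M.measure ψ A = ENNReal.ofReal (inner ℂ ψ (M.toFun A ψ)).re :=
  Measure.ofMeasurable_apply A hA

/-- `X = ∫ λ M(dλ)`, in the weak sense, for a measure `M` on a set of real numbers; this determines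
the bounded operator `X`. -/
def IsMean {Λ : Set ℝ} (M : POVM Λ H) (X : H.Op) : Prop :=
  ∀ ψ : H, inner ℂ ψ (X ψ) = ((∫ x, (x : ℝ) ∂(M.measure ψ) : ℝ) : ℂ)

end POVM

/-! ### Quantum correlation experiments -/

/-- `P` consists of the joint distributions `tr[ρ (M₁ ⊗ ⋯ ⊗ M_N)]` of the measurements `M n s` in
the state `ρ`. -/
def IsQuantumExperiment.{u, v} {N : ℕ} {H : Fin N → HilbertSp.{u}} (ρ : (tensorSpace N H).Op)
    (Λ : Fin N → Fin 2 → Type v) [∀ n s, MeasurableSpace (Λ n s)]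
    (M : (n : Fin N) → (s : Fin 2) → POVM (Λ n s) (H n))
    (P : (s : Fin N → Fin 2) → Measure ((n : Fin N) → Λ n (s n))) : Prop :=
  ∀ (s : Fin N → Fin 2) (A : (n : Fin N) → Set (Λ n (s n))), (∀ n, MeasurableSet (A n)) →
    HasTrace (ρ ∘L tensorOp N H (fun n => (M n (s n)).toFun (A n)))
      (((P s).real (Set.univ.pi A) : ℝ) : ℂ)

/-- `ρ` admits the `2 × ⋯ × 2`-setting LHV description: every correlation experiment on `ρ` with two
generalized measurements per site admits an LHV model. -/
def StateAdmitsLHV.{u, w} {N : ℕ} {H : Fin N → HilbertSp.{u}} (ρ : (tensorSpace N H).Op) : Prop :=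
  ∀ (Λ : Fin N → Fin 2 → Type) [∀ n s, MeasurableSpace (Λ n s)]
    (M : (n : Fin N) → (s : Fin 2) → POVM (Λ n s) (H n))
    (P : (s : Fin N → Fin 2) → Measure ((n : Fin N) → Λ n (s n))),
    (∀ s, IsProbabilityMeasure (P s)) → IsQuantumExperiment ρ Λ M P → AdmitsLHV.{w} Λ P

end

universe u w

/-! The Mermin–Klyshko coefficients are generated by one step, `F ↦ (η⁰ + η¹) F + (η⁰ - η¹) F'`,
where `F'` is `F` with the two settings interchanged, and `|a + b| + |a - b| ≤ 2` on the square
`[-1, 1]²`; hence each further site at most doubles the bound on the multilinear form `F`, and the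
bound is attained at `η = 1`. An LHV model averages values of `F` at points of the cube. The form is
continuous, so deterministic models with outcomes near `±1` approach the bound.

The Bell operator is the same multilinear form evaluated at tensor products of observables, and
`T ↦ tr[ρ T]` is a bounded positive functional, because `ρ = R* R` with `R` Hilbert–Schmidt.
Approximating `∫ λ M(dλ)` by integrals of simple functions, in norm, identifies `tr[ρ B]` with the
Bell sum of the correlations. For arbitrary observables with `‖X‖ ≤ 1`, the two effects
`(1 ± X) / 2` with outcomes `±1` form a measurement with mean `X`, which reduces the last claim to
the previous one. -/

section Settings

theorem sum_settings_succ {M : Type*} [AddCommMonoid M] {n : ℕ} (f : (Fin (n + 1) → Fin 2) → M) :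
    ∑ s, f s = ∑ t : Fin n → Fin 2, (f (Fin.snoc t 0) + f (Fin.snoc t 1)) := by
  rw [← (Fin.snocEquiv fun _ : Fin (n + 1) => Fin 2).sum_comp, Fintype.sum_prod_type,
    Fin.sum_univ_two, ← Finset.sum_add_distrib]
  rfl

theorem sum_settings_rev {M : Type*} [AddCommMonoid M] {n : ℕ} (f : (Fin n → Fin 2) → M) :
    ∑ s : Fin n → Fin 2, f (fun i => (s i).rev) = ∑ s, f s :=
  (Equiv.piCongrRight fun _ : Fin n => Fin.revPerm (n := 2)).sum_comp f

/-- The coefficients of `n + 1` parties obtained from the coefficients `γ` of `n` parties by the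
recursion that defines the Mermin–Klyshko coefficients. -/
def appendCoeff {R : Type*} [Ring R] {n : ℕ} (γ : (Fin n → Fin 2) → R)
    (s : Fin (n + 1) → Fin 2) : R :=
  γ (fun i => s i.castSucc) +
    (if s (Fin.last n) = 0 then 1 else -1) * γ (fun i => (s i.castSucc).rev)

theorem appendCoeff_snoc_zero {R : Type*} [Ring R] {n : ℕ} (γ : (Fin n → Fin 2) → R)
    (t : Fin n → Fin 2) :
    appendCoeff γ (Fin.snoc (α := fun _ => Fin 2) t 0) = γ t + γ (fun i => (t i).rev) := by
  simp [appendCoeff]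

theorem appendCoeff_snoc_one {R : Type*} [Ring R] {n : ℕ} (γ : (Fin n → Fin 2) → R)
    (t : Fin n → Fin 2) :
    appendCoeff γ (Fin.snoc (α := fun _ => Fin 2) t 1) = γ t - γ (fun i => (t i).rev) := by
  simp [appendCoeff, sub_eq_add_neg]

theorem map_appendCoeff {R S : Type*} [Ring R] [Ring S] (f : R →+* S) {n : ℕ}
    (γ : (Fin n → Fin 2) → R) (s : Fin (n + 1) → Fin 2) :
    f (appendCoeff γ s) = appendCoeff (fun t => f (γ t)) s := by
  simp [appendCoeff, apply_ite f]

theorem sum_appendCoeff_smul {R E F G : Type*} [CommRing R] [AddCommGroup E] [AddCommGroup F]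
    [AddCommGroup G] [Module R E] [Module R F] [Module R G] (f : E →ₗ[R] F →ₗ[R] G) {n : ℕ}
    (γ : (Fin n → Fin 2) → R) (T : (Fin n → Fin 2) → E) (B : Fin 2 → F) :
    ∑ s, appendCoeff γ s • f (T fun i => s i.castSucc) (B (s (Fin.last n))) =
      f (∑ t, γ t • T t) (B 0 + B 1) + f (∑ t, γ t • T fun i => (t i).rev) (B 0 - B 1) := by
  rw [← sum_settings_rev fun t => γ t • T fun i => (t i).rev]
  simp only [sum_settings_succ, appendCoeff_snoc_zero, appendCoeff_snoc_one, Fin.snoc_castSucc,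
    Fin.snoc_last, Fin.rev_rev, map_sum, map_smul, LinearMap.sum_apply, LinearMap.smul_apply,
    map_add, map_sub, ← Finset.sum_add_distrib, ← Finset.sum_sub_distrib]
  exact Finset.sum_congr rfl fun t _ => by module

end Settings

section Coefficients

/-- The Bell coefficients of `n + 1` parties. They are `mkCoeff (n + 1)` for `n ≥ 1`; here the
recursion starts with one party, so that the CHSH coefficients are its first instance. -/
noncomputable def bellCoeff : (n : ℕ) → (Fin (n + 1) → Fin 2) → ℝ
  | 0 => fun s => if s 0 = 0 then 1 else 0
  | n + 1 => appendCoeff (bellCoeff n)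

theorem mkCoeff_eq_bellCoeff (n : ℕ) : mkCoeff (n + 2) = bellCoeff (n + 1) := by
  induction n with
  | zero =>
    ext s
    obtain h₀ | h₀ : s 0 = 0 ∨ s 0 = 1 := by lia
    all_goals obtain h₁ | h₁ : s 1 = 0 ∨ s 1 = 1 := by lia
    all_goals simp [mkCoeff, bellCoeff, appendCoeff, Fin.last, h₀, h₁]
  | succ n ih =>
    ext s
    simp only [mkCoeff, ih, bellCoeff, appendCoeff]

theorem linForm_bellCoeff_zero (η : Fin 1 → Fin 2 → ℝ) : linForm (bellCoeff 0) η = η 0 0 := by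
  simp [linForm, sum_settings_succ, bellCoeff, Fin.snoc]

theorem linForm_bellCoeff_succ {n : ℕ} (η : Fin (n + 2) → Fin 2 → ℝ) :
    linForm (bellCoeff (n + 1)) η =
      linForm (bellCoeff n) (fun i => η i.castSucc) *
          (η (Fin.last (n + 1)) 0 + η (Fin.last (n + 1)) 1) +
        linForm (bellCoeff n) (fun i s => η i.castSucc s.rev) *
          (η (Fin.last (n + 1)) 0 - η (Fin.last (n + 1)) 1) := by
  simpa only [linForm, bellCoeff, Fin.prod_univ_castSucc, smul_eq_mul, LinearMap.mul_apply'] using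
    sum_appendCoeff_smul (LinearMap.mul ℝ ℝ) (bellCoeff n)
      (fun t => ∏ i, η i.castSucc (t i)) (η (Fin.last (n + 1)))

theorem abs_add_abs_sub_le {a b M : ℝ} (ha : |a| ≤ M) (hb : |b| ≤ M) :
    |a + b| + |a - b| ≤ M * 2 := by
  rw [abs_le] at ha hb
  rcases abs_cases (a + b) with h | h <;> rcases abs_cases (a - b) with h' | h' <;> linarith

theorem abs_mul_add_mul_sub_le {a b x y M : ℝ} (ha : |a| ≤ M) (hb : |b| ≤ M) (hx : |x| ≤ 1)
    (hy : |y| ≤ 1) : |a * (x + y) + b * (x - y)| ≤ M * 2 :=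
  calc |a * (x + y) + b * (x - y)| = |(a + b) * x + (a - b) * y| := by ring_nf
    _ ≤ |a + b| * |x| + |a - b| * |y| := by
        rw [← abs_mul, ← abs_mul]; exact abs_add_le _ _
    _ ≤ |a + b| * 1 + |a - b| * 1 := by gcongr
    _ ≤ M * 2 := by simpa only [mul_one] using abs_add_abs_sub_le ha hb

theorem abs_linForm_bellCoeff_le (n : ℕ) {η : Fin (n + 1) → Fin 2 → ℝ} (hη : ∀ i s, |η i s| ≤ 1) :
    |linForm (bellCoeff n) η| ≤ 2 ^ n := by
  induction n with
  | zero => simpa only [linForm_bellCoeff_zero, pow_zero] using hη 0 0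
  | succ n ih =>
    rw [linForm_bellCoeff_succ, pow_succ]
    exact abs_mul_add_mul_sub_le (ih fun _ _ => hη _ _) (ih fun _ _ => hη _ _) (hη _ _) (hη _ _)

theorem linForm_bellCoeff_one (n : ℕ) : linForm (bellCoeff n) (fun _ _ => 1) = 2 ^ n := by
  induction n with
  | zero => rw [linForm_bellCoeff_zero, pow_zero]
  | succ n ih => rw [linForm_bellCoeff_succ, ih]; ring

theorem isGreatest_abs_linForm_bellCoeff (n : ℕ) :
    IsGreatest ((fun η => |linForm (bellCoeff n) η|) '' {η | ∀ i s, η i s = -1 ∨ η i s = 1})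
      (2 ^ n) := by
  refine ⟨⟨fun _ _ => 1, fun _ _ => Or.inr rfl, ?_⟩, ?_⟩
  · simp only [linForm_bellCoeff_one, abs_pow, Nat.abs_ofNat]
  · rintro _ ⟨η, hη, rfl⟩
    exact abs_linForm_bellCoeff_le n fun i s => by rcases hη i s with h | h <;> simp [h]

end Coefficients

section ProductKernels

variable {ι Ω : Type*} [Fintype ι] {E : ι → Type*} [∀ i, MeasurableSpace (E i)]
  [MeasurableSpace Ω]

theorem measurable_measure_pi (κ : (i : ι) → Kernel Ω (E i)) [∀ i, IsMarkovKernel (κ i)] :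
    Measurable fun ω => Measure.pi fun i => κ i ω := by
  refine Measurable.measure_of_isPiSystem_of_isProbabilityMeasure generateFrom_pi.symm
    isPiSystem_pi ?_
  rintro _ ⟨A, hA, rfl⟩
  simp only [Measure.pi_pi]
  exact Finset.measurable_prod _ fun i _ => Kernel.measurable_coe _ (hA i (Set.mem_univ i))

/-- The kernel `ω ↦ ⨂ᵢ κ i ω` of conditionally independent outcomes. -/
noncomputable def piKernel (κ : (i : ι) → Kernel Ω (E i)) [∀ i, IsMarkovKernel (κ i)] :
    Kernel Ω ((i : ι) → E i) :=
  ⟨fun ω => Measure.pi fun i => κ i ω, measurable_measure_pi κ⟩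

variable (κ : (i : ι) → Kernel Ω (E i)) [∀ i, IsMarkovKernel (κ i)]

theorem piKernel_apply (ω : Ω) : piKernel κ ω = Measure.pi fun i => κ i ω := rfl

instance isMarkovKernel_piKernel : IsMarkovKernel (piKernel κ) :=
  ⟨fun ω => by rw [piKernel_apply]; infer_instance⟩

variable {κ}

theorem eq_bind_piKernel {ν : Measure Ω} [IsFiniteMeasure ν] {P : Measure ((i : ι) → E i)}
    (hP : ∀ A : (i : ι) → Set (E i), (∀ i, MeasurableSet (A i)) →
      P (Set.univ.pi A) = ∫⁻ ω, ∏ i, κ i ω (A i) ∂ν) :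
    P = ν.bind (piKernel κ) := by
  have bind_pi (A : (i : ι) → Set (E i)) (hA : ∀ i, MeasurableSet (A i)) :
      ν.bind (piKernel κ) (Set.univ.pi A) = P (Set.univ.pi A) := by
    rw [hP A hA, Measure.bind_apply (.univ_pi hA) (Kernel.aemeasurable _)]
    simp only [piKernel_apply, Measure.pi_pi]
  refine (ext_of_generate_finite _ generateFrom_pi.symm isPiSystem_pi ?_ ?_).symm
  · rintro _ ⟨A, hA, rfl⟩
    exact bind_pi A fun i => hA i (Set.mem_univ i)
  · simpa only [Set.pi_univ] using bind_pi (fun _ => Set.univ) fun _ => .univ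

theorem integral_bind_piKernel {𝕜 : Type*} [RCLike 𝕜] {ν : Measure Ω} [SFinite ν]
    {f : (i : ι) → E i → 𝕜}
    (hf : Integrable (fun x => ∏ i, f i (x i)) (ν.bind (piKernel κ))) :
    ∫ x, ∏ i, f i (x i) ∂(ν.bind (piKernel κ)) = ∫ ω, ∏ i, ∫ x, f i x ∂(κ i ω) ∂ν := by
  have comp_const : (piKernel κ ∘ₖ Kernel.const Unit ν) () = ν.bind (piKernel κ) := by
    rw [Kernel.comp_apply, Kernel.const_apply]
  rw [← comp_const] at hf ⊢
  rw [Kernel.integral_comp hf, Kernel.const_apply]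
  simp only [piKernel_apply, integral_fintype_prod_eq_prod]

end ProductKernels

section LHV

theorem AdmitsLHV.isProbabilityMeasure {N : ℕ} {Λ : Fin N → Fin 2 → Type*}
    [∀ n s, MeasurableSpace (Λ n s)]
    {P : (s : Fin N → Fin 2) → Measure ((n : Fin N) → Λ n (s n))} (hL : AdmitsLHV.{w} Λ P)
    (s : Fin N → Fin 2) : IsProbabilityMeasure (P s) := by
  obtain ⟨Ω, _, ν, K, _, _, h⟩ := hL
  rw [eq_bind_piKernel (h s)]
  infer_instance

theorem abs_prod_le_one {ι : Type*} [Fintype ι] {x : ι → ℝ} (hx : ∀ i, |x i| ≤ 1) :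
    |∏ i, x i| ≤ 1 := by
  rw [Finset.abs_prod]
  exact Finset.prod_le_one (fun _ _ => abs_nonneg _) fun i _ => hx i

theorem integrable_prod_outcomes {ι : Type*} [Fintype ι] {Λ : ι → Set ℝ}
    (hΛ : ∀ i, Λ i ⊆ Set.Icc (-1) 1) (μ : Measure ((i : ι) → Λ i)) [IsFiniteMeasure μ] :
    Integrable (fun x => ∏ i, (x i : ℝ)) μ :=
  .of_bound (Finset.measurable_fun_prod _ fun i _ =>
    measurable_subtype_coe.comp (measurable_pi_apply i)).aestronglyMeasurable 1
    (.of_forall fun x => abs_prod_le_one fun i => abs_le.mpr (hΛ i (x i).2))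

variable {N : ℕ} {Λ : Fin N → Fin 2 → Set ℝ}
  {P : (s : Fin N → Fin 2) → Measure ((n : Fin N) → Λ n (s n))}

theorem abs_sum_mul_corr_le (γ : (Fin N → Fin 2) → ℝ) {c : ℝ}
    (hc : ∀ η : Fin N → Fin 2 → ℝ, (∀ n s, |η n s| ≤ 1) → |linForm γ η| ≤ c)
    (hΛ : ∀ n s, Λ n s ⊆ Set.Icc (-1) 1) (hL : AdmitsLHV.{w} (fun n s => Λ n s) P) :
    |∑ s, γ s * corr Λ P s| ≤ c := by
  have hP := hL.isProbabilityMeasure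
  obtain ⟨Ω, _, ν, K, _, _, hK⟩ := hL
  let η : Ω → Fin N → Fin 2 → ℝ := fun ω n s => ∫ x, (x : ℝ) ∂(K n s ω)
  have abs_η_le (ω n s) : |η ω n s| ≤ 1 := by
    simpa using norm_integral_le_of_norm_le_const (μ := K n s ω) (f := fun x => (x : ℝ))
      (.of_forall fun x => abs_le.mpr (hΛ n s x.2))
  have integrable_η (s : Fin N → Fin 2) : Integrable (fun ω => ∏ n, η ω n (s n)) ν :=
    .of_bound (Finset.stronglyMeasurable_fun_prod _ fun n _ =>
      measurable_subtype_coe.stronglyMeasurable.integral_kernel).aestronglyMeasurable 1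
      (.of_forall fun ω => abs_prod_le_one fun n => abs_η_le ω n (s n))
  have corr_eq (s : Fin N → Fin 2) : corr Λ P s = ∫ ω, ∏ n, η ω n (s n) ∂ν := by
    have integrable := integrable_prod_outcomes (fun n => hΛ n (s n)) (P s)
    rw [eq_bind_piKernel (hK s)] at integrable
    rw [corr, eq_bind_piKernel (hK s)]
    exact integral_bind_piKernel (f := fun n (x : Λ n (s n)) => (x : ℝ)) integrable
  have sum_eq : ∑ s, γ s * corr Λ P s = ∫ ω, linForm γ (η ω) ∂ν := by
    simp only [linForm, corr_eq]
    rw [integral_finsetSum _ fun s _ => (integrable_η s).const_mul _]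
    simp only [integral_const_mul]
  rw [sum_eq]
  simpa using norm_integral_le_of_norm_le_const (μ := ν) (f := fun ω => linForm γ (η ω))
    (.of_forall fun ω => hc _ (abs_η_le ω))

theorem admitsLHV_pi_dirac {Λ : Fin N → Fin 2 → Type*} [∀ n s, MeasurableSpace (Λ n s)]
    (x : (n : Fin N) → (s : Fin 2) → Λ n s) :
    AdmitsLHV.{w} Λ fun s => Measure.pi fun n => Measure.dirac (x n (s n)) :=
  ⟨PUnit, inferInstance, Measure.dirac PUnit.unit,
    fun n s => Kernel.const _ (Measure.dirac (x n s)), inferInstance, fun n s => inferInstance,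
    fun s A _ => by simp [Measure.pi_pi]⟩

theorem corr_pi_dirac (x : (n : Fin N) → (s : Fin 2) → Λ n s) (s : Fin N → Fin 2) :
    corr Λ (fun s => Measure.pi fun n => Measure.dirac (x n (s n))) s = ∏ n, (x n (s n) : ℝ) := by
  rw [corr, integral_fintype_prod_eq_prod (fun n (y : Λ n (s n)) => (y : ℝ))]
  simp only [integral_dirac]

theorem continuous_linForm (γ : (Fin N → Fin 2) → ℝ) : Continuous (linForm γ) := by
  unfold linForm
  fun_prop

theorem abs_linForm_le_of_mem_closure (γ : (Fin N → Fin 2) → ℝ) {c : ℝ}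
    (hc : ∀ x : (n : Fin N) → (s : Fin 2) → Λ n s, |linForm γ fun n s => x n s| ≤ c)
    {η : Fin N → Fin 2 → ℝ} (hη : ∀ n s, η n s ∈ closure (Λ n s)) : |linForm γ η| ≤ c := by
  have η_mem : η ∈ closure (Set.univ.pi fun n => Set.univ.pi (Λ n)) := by
    simp only [closure_pi_set]
    exact fun n _ s _ => hη n s
  have subset : (Set.univ.pi fun n => Set.univ.pi (Λ n)) ⊆ {η | |linForm γ η| ≤ c} :=
    fun x hx => hc fun n s => ⟨x n s, hx n trivial s trivial⟩
  exact closure_minimal subset (isClosed_le (continuous_linForm γ).abs continuous_const) η_mem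

theorem isLUB_abs_sum_mul_corr (γ : (Fin N → Fin 2) → ℝ) {c : ℝ}
    (hc : ∀ η : Fin N → Fin 2 → ℝ, (∀ n s, |η n s| ≤ 1) → |linForm γ η| ≤ c)
    {η : Fin N → Fin 2 → ℝ} (hη : |linForm γ η| = c) (hΛ : ∀ n s, Λ n s ⊆ Set.Icc (-1) 1)
    (η_mem : ∀ n s, η n s ∈ closure (Λ n s)) :
    IsLUB
      {r : ℝ | ∃ P : (s : Fin N → Fin 2) → Measure ((n : Fin N) → Λ n (s n)),
        (∀ s, IsProbabilityMeasure (P s)) ∧ AdmitsLHV.{w} (fun n s => Λ n s) P ∧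
          r = |∑ s, γ s * corr Λ P s|} c := by
  refine ⟨?_, fun d hd => ?_⟩
  · rintro _ ⟨P, -, hL, rfl⟩
    exact abs_sum_mul_corr_le γ hc hΛ hL
  · rw [← hη]
    refine abs_linForm_le_of_mem_closure γ (fun x => ?_) η_mem
    have hL := admitsLHV_pi_dirac.{w} x
    refine hd ⟨_, hL.isProbabilityMeasure, hL, ?_⟩
    simp only [linForm, corr_pi_dirac]

theorem isLUB_abs_sum_bellCoeff_mul_corr (n : ℕ) {Λ : Fin (n + 1) → Fin 2 → Set ℝ}
    (hglb : ∀ i s, IsGLB (Λ i s) (-1)) (hlub : ∀ i s, IsLUB (Λ i s) 1) :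
    IsLUB
      {r : ℝ | ∃ P : (s : Fin (n + 1) → Fin 2) → Measure ((i : Fin (n + 1)) → Λ i (s i)),
        (∀ s, IsProbabilityMeasure (P s)) ∧ AdmitsLHV.{w} (fun i s => Λ i s) P ∧
          r = |∑ s, bellCoeff n s * corr Λ P s|} (2 ^ n) := by
  refine isLUB_abs_sum_mul_corr _ (fun _ => abs_linForm_bellCoeff_le n)
    (η := fun _ _ => 1) ?_ (fun i s x hx => ⟨(hglb i s).1 hx, (hlub i s).1 hx⟩)
    fun i s => (hlub i s).mem_closure (hlub i s).nonempty
  simp only [linForm_bellCoeff_one, abs_pow, Nat.abs_ofNat]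

end LHV

section HilbertSchmidt

open scoped InnerProductSpace

variable {𝕜 D E F ι κ : Type*} [RCLike 𝕜]
  [NormedAddCommGroup D] [InnerProductSpace 𝕜 D] [CompleteSpace D]
  [NormedAddCommGroup E] [InnerProductSpace 𝕜 E] [CompleteSpace E]
  [NormedAddCommGroup F] [InnerProductSpace 𝕜 F] [CompleteSpace F]

omit [CompleteSpace F] in
theorem hasSum_norm_inner_sq (c : HilbertBasis κ 𝕜 F) (y : F) :
    HasSum (fun j => ‖⟪y, c j⟫_𝕜‖ ^ 2) (‖y‖ ^ 2) := by
  simpa [c.repr_apply_apply, norm_inner_symm] using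
    lp.hasSum_norm (p := 2) (by norm_num) (c.repr y)

omit [CompleteSpace F] in
theorem summable_norm_inner_sq (c : HilbertBasis κ 𝕜 F) {y : ι → F}
    (hy : Summable fun i => ‖y i‖ ^ 2) :
    Summable fun p : ι × κ => ‖⟪y p.1, c p.2⟫_𝕜‖ ^ 2 := by
  rw [summable_prod_of_nonneg fun _ => sq_nonneg _]
  refine ⟨fun i => (hasSum_norm_inner_sq c (y i)).summable, ?_⟩
  simpa only [fun i => (hasSum_norm_inner_sq c (y i)).tsum_eq] using hy

omit [CompleteSpace F] in
theorem summable_inner_mul_inner (c : HilbertBasis κ 𝕜 F) {x y : ι → F}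
    (hx : Summable fun i => ‖x i‖ ^ 2) (hy : Summable fun i => ‖y i‖ ^ 2) :
    Summable fun p : ι × κ => ⟪x p.1, c p.2⟫_𝕜 * ⟪c p.2, y p.1⟫_𝕜 := by
  refine .of_norm_bounded ((summable_norm_inner_sq c hx).add (summable_norm_inner_sq c hy))
    fun p => ?_
  rw [norm_mul, norm_inner_symm (c p.2)]
  linarith [two_mul_le_add_sq ‖⟪x p.1, c p.2⟫_𝕜‖ ‖⟪y p.1, c p.2⟫_𝕜‖,
    mul_nonneg (norm_nonneg ⟪x p.1, c p.2⟫_𝕜) (norm_nonneg ⟪y p.1, c p.2⟫_𝕜)]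

theorem exists_hasSum_inner_adjoint (b : HilbertBasis ι 𝕜 E) (c : HilbertBasis κ 𝕜 F)
    {A B : E →L[𝕜] F} (hA : Summable fun i => ‖A (b i)‖ ^ 2)
    (hB : Summable fun i => ‖B (b i)‖ ^ 2) :
    ∃ z : 𝕜, HasSum (fun i => ⟪A (b i), B (b i)⟫_𝕜) z ∧
      HasSum (fun j => ⟪B.adjoint (c j), A.adjoint (c j)⟫_𝕜) z := by
  obtain ⟨z, hz⟩ := summable_inner_mul_inner c hA hB
  refine ⟨z, hz.prod_fiberwise fun i => c.hasSum_inner_mul_inner _ _, ?_⟩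
  refine ((Equiv.prodComm κ ι).hasSum_iff.mpr hz).prod_fiberwise fun j => ?_
  refine (b.hasSum_inner_mul_inner (B.adjoint (c j)) (A.adjoint (c j))).congr_fun fun i => ?_
  rw [ContinuousLinearMap.adjoint_inner_left, ContinuousLinearMap.adjoint_inner_right, mul_comm]
  rfl

theorem summable_norm_adjoint_sq (b : HilbertBasis ι 𝕜 E) (c : HilbertBasis κ 𝕜 F)
    {A : E →L[𝕜] F} (hA : Summable fun i => ‖A (b i)‖ ^ 2) :
    Summable fun j => ‖A.adjoint (c j)‖ ^ 2 := by
  obtain ⟨z, -, h⟩ := exists_hasSum_inner_adjoint b c hA hA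
  simpa only [inner_self_eq_norm_sq_to_K, ← RCLike.ofReal_pow, RCLike.summable_ofReal] using
    h.summable

theorem summable_norm_comp_sq (d : HilbertBasis κ 𝕜 D) (b : HilbertBasis ι 𝕜 E) {R : E →L[𝕜] F}
    (hR : Summable fun i => ‖R (b i)‖ ^ 2) (T : D →L[𝕜] E) :
    Summable fun k => ‖(R ∘L T) (d k)‖ ^ 2 := by
  obtain ⟨_, c, -⟩ := exists_hilbertBasis 𝕜 F
  rw [← ContinuousLinearMap.adjoint_adjoint (R ∘L T), ContinuousLinearMap.adjoint_comp]
  refine summable_norm_adjoint_sq c d (.of_nonneg_of_le (fun _ => sq_nonneg _) (fun j => ?_)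
    ((summable_norm_adjoint_sq b c hR).mul_left (‖T.adjoint‖ ^ 2)))
  rw [← mul_pow]
  gcongr
  exact T.adjoint.le_opNorm _

theorem exists_hasSum_inner_adjoint_comp_self (b : HilbertBasis ι 𝕜 E) (c : HilbertBasis κ 𝕜 F)
    {R : E →L[𝕜] F} (hR : Summable fun i => ‖R (b i)‖ ^ 2) (T : E →L[𝕜] E) :
    ∃ z : 𝕜, HasSum (fun i => ⟪b i, (R.adjoint ∘L R ∘L T) (b i)⟫_𝕜) z ∧
      HasSum (fun j => ⟪R.adjoint (c j), T (R.adjoint (c j))⟫_𝕜) z := by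
  obtain ⟨z, hz, hz'⟩ := exists_hasSum_inner_adjoint b c hR (summable_norm_comp_sq b b hR T)
  refine ⟨z, ?_, ?_⟩
  · simpa only [ContinuousLinearMap.comp_apply, ContinuousLinearMap.adjoint_inner_right] using hz
  · simpa only [ContinuousLinearMap.adjoint_comp, ContinuousLinearMap.comp_apply,
      ContinuousLinearMap.adjoint_inner_left] using hz'

end HilbertSchmidt

section Expectation

open scoped ComplexOrder

theorem HasTrace.unique {H : HilbertSp.{u}} {T : H.Op} {z z' : ℂ} (h : HasTrace T z)
    (h' : HasTrace T z') : z = z' := by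
  obtain ⟨_, b, -⟩ := exists_hilbertBasis ℂ H
  exact (h _ b).unique (h' _ b)

/-- The functional `T ↦ ⟪ψ, T ψ⟫`. -/
noncomputable def vectorFunctional {H : HilbertSp.{u}} (ψ : H) : H.Op →L[ℂ] ℂ :=
  innerSL ℂ ψ ∘L ContinuousLinearMap.apply ℂ H ψ

theorem vectorFunctional_apply {H : HilbertSp.{u}} (ψ : H) (T : H.Op) :
    vectorFunctional ψ T = inner ℂ ψ (T ψ) := rfl

theorem norm_vectorFunctional_le {H : HilbertSp.{u}} (ψ : H) :
    ‖vectorFunctional ψ‖ ≤ ‖ψ‖ ^ 2 := by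
  refine ContinuousLinearMap.opNorm_le_bound _ (sq_nonneg _) fun T => ?_
  calc ‖inner ℂ ψ (T ψ)‖ ≤ ‖ψ‖ * (‖T‖ * ‖ψ‖) :=
        (norm_inner_le_norm _ _).trans (by gcongr; exact T.le_opNorm _)
    _ = ‖ψ‖ ^ 2 * ‖T‖ := by ring

theorem IsState.exists_sqrt {H : HilbertSp.{u}} {ρ : H.Op} (hρ : IsState ρ) :
    ∃ R : H.Op, R.adjoint ∘L R = ρ ∧
      ∀ (ι : Type u) (b : HilbertBasis ι ℂ H), Summable fun i => ‖R (b i)‖ ^ 2 := by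
  have sqrt_comp : (CFC.sqrt ρ).adjoint ∘L CFC.sqrt ρ = ρ := by
    rw [(IsSelfAdjoint.of_nonneg (CFC.sqrt_nonneg ρ)).adjoint_eq]
    exact CFC.sqrt_mul_sqrt_self ρ (ContinuousLinearMap.nonneg_iff_isPositive ρ |>.mpr hρ.1)
  refine ⟨CFC.sqrt ρ, sqrt_comp, fun ι b => ?_⟩
  have summable := (hρ.2 ι b).summable
  rw [← sqrt_comp] at summable
  simpa only [ContinuousLinearMap.comp_apply, ContinuousLinearMap.adjoint_inner_right,
    inner_self_eq_norm_sq_to_K, ← RCLike.ofReal_pow, RCLike.summable_ofReal] using summable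

theorem IsState.exists_expectation {H : HilbertSp.{u}} {ρ : H.Op} (hρ : IsState ρ) :
    ∃ φ : H.Op →L[ℂ] ℂ, (∀ T, HasTrace (ρ ∘L T) (φ T)) ∧ ∀ T, T.IsPositive → 0 ≤ φ T := by
  obtain ⟨R, rfl, hR⟩ := hρ.exists_sqrt
  obtain ⟨_, c, -⟩ := exists_hilbertBasis ℂ H
  obtain ⟨φ, hφ⟩ : Summable fun j => vectorFunctional (R.adjoint (c j)) :=
    .of_norm_bounded (summable_norm_adjoint_sq c c (hR _ c)) fun j => norm_vectorFunctional_le _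
  have hasSum (T : H.Op) :
      HasSum (fun j => inner ℂ (R.adjoint (c j)) (T (R.adjoint (c j)))) (φ T) := by
    simpa only [ContinuousLinearMap.apply_apply, vectorFunctional_apply] using
      (ContinuousLinearMap.apply ℂ ℂ T).hasSum hφ
  refine ⟨φ, fun T ι b => ?_, fun T hT => (hasSum T).nonneg fun j => hT.inner_nonneg_right _⟩
  obtain ⟨z, hz, hz'⟩ := exists_hasSum_inner_adjoint_comp_self b c (hR ι b) T
  rwa [(hasSum T).unique hz']

end Expectation

section TensorProducts

namespace HilbertSp

variable {H K : HilbertSp.{u}}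

/-- The isometric inclusion of the algebraic tensor product in the Hilbert space one. -/
noncomputable def tensorIncl (H K : HilbertSp.{u}) : (H ⊗[ℂ] K) →ₗᵢ[ℂ] H.tensor K :=
  UniformSpace.Completion.toComplₗᵢ

theorem denseRange_tensorIncl (H K : HilbertSp.{u}) : DenseRange (tensorIncl H K) :=
  UniformSpace.Completion.denseRange_coe

theorem opTensor_tensorIncl (A : H.Op) (B : K.Op) (x : H ⊗[ℂ] K) :
    opTensor A B (tensorIncl H K x) = tensorIncl H K (TensorProduct.mapL A B x) :=
  ContinuousLinearMap.completion_apply_coe _ _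

theorem tensor_ext {A B : (H.tensor K).Op}
    (h : ∀ x : H ⊗[ℂ] K, A (tensorIncl H K x) = B (tensorIncl H K x)) : A = B :=
  ContinuousLinearMap.ext fun x => (denseRange_tensorIncl H K).induction_on x
    (isClosed_eq A.continuous B.continuous) h

theorem opTensor_add_left (A A' : H.Op) (B : K.Op) :
    opTensor (A + A') B = opTensor A B + opTensor A' B :=
  tensor_ext fun x => by
    simp [opTensor_tensorIncl, TensorProduct.mapL_add_left, -TensorProduct.mapL_apply]

theorem opTensor_add_right (A : H.Op) (B B' : K.Op) :
    opTensor A (B + B') = opTensor A B + opTensor A B' :=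
  tensor_ext fun x => by
    simp [opTensor_tensorIncl, TensorProduct.mapL_add_right, -TensorProduct.mapL_apply]

theorem opTensor_smul_left (a : ℂ) (A : H.Op) (B : K.Op) :
    opTensor (a • A) B = a • opTensor A B :=
  tensor_ext fun x => by
    simp [opTensor_tensorIncl, TensorProduct.mapL_smul_left, -TensorProduct.mapL_apply]

theorem opTensor_smul_right (a : ℂ) (A : H.Op) (B : K.Op) :
    opTensor A (a • B) = a • opTensor A B :=
  tensor_ext fun x => by
    simp [opTensor_tensorIncl, TensorProduct.mapL_smul_right, -TensorProduct.mapL_apply]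

theorem opTensor_one_one : opTensor (1 : H.Op) (1 : K.Op) = 1 :=
  tensor_ext fun x => by simp [opTensor_tensorIncl]

theorem opTensor_mul (A A' : H.Op) (B B' : K.Op) :
    opTensor (A * A') (B * B') = opTensor A B * opTensor A' B' :=
  tensor_ext fun x => by
    simp [opTensor_tensorIncl, TensorProduct.mapL_mul, -TensorProduct.mapL_apply]

theorem norm_opTensor_le (A : H.Op) (B : K.Op) : ‖opTensor A B‖ ≤ ‖A‖ * ‖B‖ := by
  refine ContinuousLinearMap.opNorm_le_bound _ (by positivity) fun x =>
    (denseRange_tensorIncl H K).induction_on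
      (p := fun x => ‖opTensor A B x‖ ≤ ‖A‖ * ‖B‖ * ‖x‖) x ?_ fun x => ?_
  · exact isClosed_le (opTensor A B).continuous.norm (continuous_const.mul continuous_norm)
  · rw [opTensor_tensorIncl, LinearIsometry.norm_map, LinearIsometry.norm_map]
    exact ((TensorProduct.mapL A B).le_opNorm x).trans
      (by gcongr; exact TensorProduct.norm_mapL_le A B)

/-- `opTensor` as a continuous bilinear map. -/
noncomputable def opTensorL (H K : HilbertSp.{u}) : H.Op →L[ℂ] K.Op →L[ℂ] (H.tensor K).Op :=
  LinearMap.mkContinuous₂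
    (LinearMap.mk₂ ℂ opTensor opTensor_add_left opTensor_smul_left opTensor_add_right
      opTensor_smul_right)
    1 fun A B => (norm_opTensor_le A B).trans_eq (by rw [one_mul])

theorem inner_mapL_left {A : H.Op} {B : K.Op} (hA : IsSelfAdjoint A) (hB : IsSelfAdjoint B)
    (x y : H ⊗[ℂ] K) :
    inner ℂ (TensorProduct.mapL A B x) y = inner ℂ x (TensorProduct.mapL A B y) := by
  rw [ContinuousLinearMap.isSelfAdjoint_iff_isSymmetric] at hA hB
  induction x with
  | zero => simp
  | add x x' hx hx' => simp only [map_add, inner_add_left, hx, hx']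
  | tmul a b =>
    induction y with
    | zero => simp
    | add y y' hy hy' => simp only [map_add, inner_add_right, hy, hy']
    | tmul c d =>
      rw [TensorProduct.mapL_tmul, TensorProduct.mapL_tmul, TensorProduct.inner_tmul,
        TensorProduct.inner_tmul]
      exact congrArg₂ _ (hA a c) (hB b d)

theorem isSelfAdjoint_opTensor {A : H.Op} {B : K.Op} (hA : IsSelfAdjoint A)
    (hB : IsSelfAdjoint B) : IsSelfAdjoint (opTensor A B) := by
  rw [ContinuousLinearMap.isSelfAdjoint_iff_isSymmetric]
  refine fun x y => (denseRange_tensorIncl H K).induction_on₂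
    (p := fun x y => inner ℂ (opTensor A B x) y = inner ℂ x (opTensor A B y)) ?_
    (fun x y => ?_) x y
  · exact isClosed_eq
      (((opTensor A B).continuous.comp continuous_fst).inner continuous_snd)
      (continuous_fst.inner ((opTensor A B).continuous.comp continuous_snd))
  · simp only [opTensor_tensorIncl, LinearIsometry.inner_map_map, inner_mapL_left hA hB]

theorem isPositive_opTensor {A : H.Op} {B : K.Op} (hA : A.IsPositive) (hB : B.IsPositive) :
    (opTensor A B).IsPositive := by
  rw [← ContinuousLinearMap.nonneg_iff_isPositive] at *
  rw [← CFC.sqrt_mul_sqrt_self A, ← CFC.sqrt_mul_sqrt_self B, opTensor_mul]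
  exact (isSelfAdjoint_opTensor (.of_nonneg (CFC.sqrt_nonneg A))
    (.of_nonneg (CFC.sqrt_nonneg B))).mul_self_nonneg

end HilbertSp

/-- `tensorOp` as a continuous multilinear map. -/
noncomputable def tensorOpL : (N : ℕ) → (H : Fin N → HilbertSp.{u}) →
    ContinuousMultilinearMap ℂ (fun n => (H n).Op) (tensorSpace N H).Op
  | 0, _ => ContinuousMultilinearMap.constOfIsEmpty ℂ _ (ContinuousLinearMap.id ℂ _)
  | 1, _ => ContinuousMultilinearMap.uncurryRight
      (ContinuousMultilinearMap.constOfIsEmpty ℂ _ (ContinuousLinearMap.id ℂ _))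
  | n + 2, H => ContinuousMultilinearMap.uncurryRight
      ((HilbertSp.opTensorL (tensorSpace (n + 1) fun i => H i.castSucc)
          (H (Fin.last (n + 1)))).compContinuousMultilinearMap
        (tensorOpL (n + 1) fun i => H i.castSucc))

theorem tensorOpL_apply : (N : ℕ) → (H : Fin N → HilbertSp.{u}) → (A : (n : Fin N) → (H n).Op) →
    tensorOpL N H A = tensorOp N H A
  | 0, _, _ => rfl
  | 1, _, _ => rfl
  | n + 2, H, A => congrArg (HilbertSp.opTensor · (A (Fin.last (n + 1))))
      (tensorOpL_apply (n + 1) (fun i => H i.castSucc) fun i => A i.castSucc)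

theorem tensorOp_one : (N : ℕ) → (H : Fin N → HilbertSp.{u}) → tensorOp N H (fun _ => 1) = 1
  | 0, _ => rfl
  | 1, _ => rfl
  | n + 2, H => (congrArg (HilbertSp.opTensor · 1)
      (tensorOp_one (n + 1) fun i => H i.castSucc)).trans HilbertSp.opTensor_one_one

theorem isPositive_tensorOp : (N : ℕ) → (H : Fin N → HilbertSp.{u}) →
    (A : (n : Fin N) → (H n).Op) → (∀ n, (A n).IsPositive) → (tensorOp N H A).IsPositive
  | 0, _, _, _ => ContinuousLinearMap.isPositive_one
  | 1, _, _, hA => hA 0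
  | n + 2, _, _, hA => HilbertSp.isPositive_opTensor
      (isPositive_tensorOp (n + 1) _ _ fun i => hA i.castSucc) (hA (Fin.last (n + 1)))

theorem bellOp_eq_sum : (n : ℕ) → (H : Fin (n + 1) → HilbertSp.{u}) →
    (X : (i : Fin (n + 1)) → Fin 2 → (H i).Op) →
    bellOp (n + 1) H X = ∑ s, (bellCoeff n s : ℂ) • tensorOp (n + 1) H fun i => X i (s i)
  | 0, H, X => by
    simp only [sum_settings_succ, bellCoeff, Fin.snoc_zero, Fintype.sum_unique, if_true,
      one_ne_zero, if_false, Complex.ofReal_one, Complex.ofReal_zero, one_smul, zero_smul, add_zero]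
    rfl
  | n + 1, H, X => by
    have append_last := sum_appendCoeff_smul
      (ContinuousLinearMap.coeLM ℂ ∘ₗ (HilbertSp.opTensorL
        (tensorSpace (n + 1) fun i => H i.castSucc) (H (Fin.last (n + 1)))).toLinearMap)
      (fun t => Complex.ofRealHom (bellCoeff n t))
      (fun t => tensorOp (n + 1) (fun i => H i.castSucc) fun i => X i.castSucc (t i))
      (X (Fin.last (n + 1)))
    simp only [← map_appendCoeff Complex.ofRealHom (bellCoeff n)] at append_last
    simp only [Complex.ofRealHom_eq_coe] at append_last
    rw [← bellOp_eq_sum n, ← bellOp_eq_sum n _ fun i s => X i.castSucc s.rev] at append_last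
    exact append_last.symm

end TensorProducts

section Integration

theorem norm_le_of_inner_self_eq_ofReal {E : Type*} [NormedAddCommGroup E] [InnerProductSpace ℂ E]
    {T : E →L[ℂ] E} {q : E → ℝ} {c : ℝ} (hc : 0 ≤ c) (hq : ∀ ψ, inner ℂ ψ (T ψ) = q ψ)
    (hqc : ∀ ψ, |q ψ| ≤ c * ‖ψ‖ ^ 2) : ‖T‖ ≤ c := by
  have inner_left (ψ : E) : inner ℂ (T ψ) ψ = q ψ := by
    rw [← inner_conj_symm, hq, Complex.conj_ofReal]
  have symmetric : (T : E →ₗ[ℂ] E).IsSymmetric :=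
    (LinearMap.isSymmetric_iff_inner_map_self_real _).mpr fun ψ => by
      rw [ContinuousLinearMap.coe_coe, inner_left, Complex.conj_ofReal]
  rw [ContinuousLinearMap.norm_eq_iSup_rayleighQuotient T symmetric]
  refine ciSup_le fun ψ => ?_
  rw [ContinuousLinearMap.rayleighQuotient, ContinuousLinearMap.reApplyInnerSelf_apply, inner_left,
    abs_div, abs_of_nonneg (sq_nonneg ‖ψ‖)]
  exact div_le_of_le_mul₀ (sq_nonneg _) hc (hqc ψ)

theorem exists_simpleFunc_abs_sub_le {α : Type*} [MeasurableSpace α] {f : α → ℝ}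
    (hf : Measurable f) {C : ℝ} (hC : ∀ x, |f x| ≤ C) {ε : ℝ} (hε : 0 < ε) :
    ∃ g : SimpleFunc α ℝ, ∀ x, |f x - g x| ≤ ε := by
  have measurable_floor : Measurable fun x => ⌊f x / ε⌋ :=
    Int.measurable_floor.comp (hf.div_const ε)
  have finite_range : (Set.range fun x => ⌊f x / ε⌋).Finite := by
    refine (Set.finite_Icc ⌊-C / ε⌋ ⌊C / ε⌋).subset ?_
    rintro _ ⟨x, rfl⟩
    exact ⟨Int.floor_mono (by gcongr; exact (abs_le.mp (hC x)).1),
      Int.floor_mono (by gcongr; exact (abs_le.mp (hC x)).2)⟩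
  let floorFunc : SimpleFunc α ℤ :=
    ⟨_, fun k => measurable_floor (measurableSet_singleton k), finite_range⟩
  refine ⟨floorFunc.map fun k : ℤ => (k : ℝ) * ε, fun x => ?_⟩
  have sub_floor : f x - ⌊f x / ε⌋ * ε = Int.fract (f x / ε) * ε := by
    rw [Int.fract, sub_mul, div_mul_cancel₀ _ hε.ne']
  change |f x - ⌊f x / ε⌋ * ε| ≤ ε
  rw [sub_floor, abs_of_nonneg (mul_nonneg (Int.fract_nonneg _) hε.le)]
  exact mul_le_of_le_one_left hε.le (Int.fract_lt_one _).le

theorem tendsto_of_norm_sub_le_one_div {E : Type*} [SeminormedAddCommGroup E] {u : ℕ → E} {a : E}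
    (hu : ∀ m, ‖a - u m‖ ≤ 1 / ((m : ℝ) + 1)) : Filter.Tendsto u .atTop (nhds a) := by
  rw [tendsto_iff_norm_sub_tendsto_zero]
  refine squeeze_zero (fun _ => norm_nonneg _) (fun m => ?_)
    (tendsto_one_div_add_atTop_nhds_zero_nat (𝕜 := ℝ))
  rw [norm_sub_rev]
  exact hu m

namespace POVM

variable {Λ : Type*} [MeasurableSpace Λ] {H : HilbertSp.{u}}

theorem inner_toFun (M : POVM Λ H) (ψ : H) {A : Set Λ} (hA : MeasurableSet A) :
    inner ℂ ψ (M.toFun A ψ) = ((M.measure ψ).real A : ℂ) := by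
  have re_nonneg : 0 ≤ (inner ℂ ψ (M.toFun A ψ)).re :=
    (M.isPositive A hA).re_inner_nonneg_right ψ
  rw [measureReal_def, M.measure_apply ψ hA, ENNReal.toReal_ofReal re_nonneg]
  exact Complex.ext rfl ((M.isPositive A hA).isSymmetric.im_inner_self_apply ψ)

theorem measure_univ (M : POVM Λ H) (ψ : H) :
    M.measure ψ Set.univ = ENNReal.ofReal (‖ψ‖ ^ 2) := by
  rw [M.measure_apply ψ .univ, M.map_univ]
  exact congrArg _ (inner_self_eq_norm_sq (𝕜 := ℂ) ψ)

instance isFiniteMeasure_measure (M : POVM Λ H) (ψ : H) : IsFiniteMeasure (M.measure ψ) :=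
  ⟨by rw [M.measure_univ]; exact ENNReal.ofReal_lt_top⟩

theorem measureReal_univ (M : POVM Λ H) (ψ : H) : (M.measure ψ).real Set.univ = ‖ψ‖ ^ 2 := by
  rw [measureReal_def, M.measure_univ, ENNReal.toReal_ofReal (sq_nonneg _)]

/-- The operator `∫ f(λ) M(dλ)` for a simple function `f`. -/
noncomputable def simpleIntegral (M : POVM Λ H) (f : SimpleFunc Λ ℝ) : H.Op :=
  ∑ r ∈ f.range, (r : ℂ) • M.toFun (f ⁻¹' {r})

theorem inner_simpleIntegral (M : POVM Λ H) (f : SimpleFunc Λ ℝ) (ψ : H) :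
    inner ℂ ψ (M.simpleIntegral f ψ) = ((∫ x, f x ∂(M.measure ψ) : ℝ) : ℂ) := by
  rw [← SimpleFunc.integral_eq_integral f f.integrable_of_isFiniteMeasure, SimpleFunc.integral_eq]
  simp only [simpleIntegral, FunLike.coe_sum, Finset.sum_apply, FunLike.coe_smul, Pi.smul_apply,
    inner_sum, inner_smul_right, M.inner_toFun ψ (f.measurableSet_fiber _), smul_eq_mul,
    Complex.ofReal_sum, Complex.ofReal_mul, mul_comm]

theorem norm_sub_simpleIntegral_le (M : POVM Λ H) {X : H.Op} {f : Λ → ℝ}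
    (hf : ∀ ψ, Integrable f (M.measure ψ))
    (hX : ∀ ψ, inner ℂ ψ (X ψ) = ((∫ x, f x ∂(M.measure ψ) : ℝ) : ℂ)) {g : SimpleFunc Λ ℝ} {ε : ℝ}
    (hε : 0 ≤ ε) (hg : ∀ x, |f x - g x| ≤ ε) : ‖X - M.simpleIntegral g‖ ≤ ε := by
  refine norm_le_of_inner_self_eq_ofReal (q := fun ψ => ∫ x, (f x - g x) ∂(M.measure ψ)) hε
    (fun ψ => ?_) fun ψ => ?_
  · rw [integral_sub (hf ψ) g.integrable_of_isFiniteMeasure, Complex.ofReal_sub, ← hX,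
      ← M.inner_simpleIntegral, ← inner_sub_right, sub_apply]
  · rw [← M.measureReal_univ]
    exact norm_integral_le_of_norm_le_const (f := fun x => f x - g x) (.of_forall hg)

end POVM

variable {N : ℕ} {H : Fin N → HilbertSp.{u}} {Λ : Fin N → Type*} [∀ n, MeasurableSpace (Λ n)]

theorem integral_prod_simpleFunc (P : Measure ((n : Fin N) → Λ n)) [IsFiniteMeasure P]
    (f : (n : Fin N) → SimpleFunc (Λ n) ℝ) :
    ∫ x, ∏ n, f n (x n) ∂P = ∑ r ∈ Fintype.piFinset fun n => (f n).range,
      (∏ n, r n) * P.real (Set.univ.pi fun n => f n ⁻¹' {r n}) := by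
  have measurableSet_cell (r : Fin N → ℝ) : MeasurableSet (Set.univ.pi fun n => f n ⁻¹' {r n}) :=
    .univ_pi fun n => (f n).measurableSet_fiber _
  have prod_eq (x : (n : Fin N) → Λ n) : ∏ n, f n (x n) =
      ∑ r ∈ Fintype.piFinset fun n => (f n).range,
        (Set.univ.pi fun n => f n ⁻¹' {r n}).indicator (fun _ => ∏ n, r n) x := by
    rw [Finset.sum_eq_single_of_mem (fun n => f n (x n))
      (Fintype.mem_piFinset.mpr fun n => (f n).mem_range_self _)]
    · rw [Set.indicator_of_mem]
      exact fun _ _ => rfl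
    · exact fun r _ hr => Set.indicator_of_notMem
        (fun hx => hr (funext fun n => (hx n trivial).symm)) _
  simp only [prod_eq]
  rw [integral_finsetSum _ fun r _ => (integrable_const _).indicator (measurableSet_cell r)]
  refine Finset.sum_congr rfl fun r _ => ?_
  rw [integral_indicator_const _ (measurableSet_cell r), smul_eq_mul, mul_comm]

variable {φ : (tensorSpace N H).Op →L[ℂ] ℂ} {M : (n : Fin N) → POVM (Λ n) (H n)}
  {P : Measure ((n : Fin N) → Λ n)} [IsFiniteMeasure P]

theorem map_tensorOp_simpleIntegral
    (hP : ∀ A : (n : Fin N) → Set (Λ n), (∀ n, MeasurableSet (A n)) →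
      φ (tensorOp N H fun n => (M n).toFun (A n)) = (P.real (Set.univ.pi A) : ℂ))
    (f : (n : Fin N) → SimpleFunc (Λ n) ℝ) :
    φ (tensorOp N H fun n => (M n).simpleIntegral (f n)) =
      ((∫ x, ∏ n, f n (x n) ∂P : ℝ) : ℂ) := by
  simp only [POVM.simpleIntegral]
  rw [← tensorOpL_apply, ContinuousMultilinearMap.map_sum_finset, integral_prod_simpleFunc, map_sum,
    Complex.ofReal_sum]
  refine Finset.sum_congr rfl fun r _ => ?_
  rw [ContinuousMultilinearMap.map_smul_univ, tensorOpL_apply, map_smul,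
    hP _ fun n => (f n).measurableSet_fiber _, Complex.ofReal_mul, Complex.ofReal_prod, smul_eq_mul]

theorem tendsto_integral_prod {g : ℕ → (n : Fin N) → SimpleFunc (Λ n) ℝ}
    {f : (n : Fin N) → Λ n → ℝ} {C : ℝ} (hC : ∀ m n x, |g m n x| ≤ C)
    (hg : ∀ n x, Filter.Tendsto (fun m => g m n x) .atTop (nhds (f n x))) :
    Filter.Tendsto (fun m => ∫ x, ∏ n, g m n (x n) ∂P) .atTop
      (nhds (∫ x, ∏ n, f n (x n) ∂P)) := by
  refine tendsto_integral_of_dominated_convergence (fun _ => ∏ _ : Fin N, C) (fun m => ?_)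
    (integrable_const _) (fun m => .of_forall fun x => ?_)
    (.of_forall fun x => tendsto_finsetProd _ fun n _ => hg n (x n))
  · exact (Finset.measurable_fun_prod _ fun n _ =>
      (g m n).measurable.comp (measurable_pi_apply n)).aestronglyMeasurable
  · rw [norm_prod]
    exact Finset.prod_le_prod (fun _ _ => norm_nonneg _) fun n _ => hC m n (x n)

theorem map_tensorOp_eq_integral
    (hP : ∀ A : (n : Fin N) → Set (Λ n), (∀ n, MeasurableSet (A n)) →
      φ (tensorOp N H fun n => (M n).toFun (A n)) = (P.real (Set.univ.pi A) : ℂ))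
    {f : (n : Fin N) → Λ n → ℝ} (hf : ∀ n, Measurable (f n)) {C : ℝ} (hC : ∀ n x, |f n x| ≤ C)
    {X : (n : Fin N) → (H n).Op}
    (hX : ∀ n ψ, inner ℂ ψ (X n ψ) = ((∫ x, f n x ∂((M n).measure ψ) : ℝ) : ℂ)) :
    φ (tensorOp N H X) = ((∫ x, ∏ n, f n (x n) ∂P : ℝ) : ℂ) := by
  choose g hg using fun (m : ℕ) n => exists_simpleFunc_abs_sub_le (hf n) (hC n)
    (Nat.one_div_pos_of_nat (α := ℝ) (n := m))
  have abs_g_le (m n) (x : Λ n) : |g m n x| ≤ C + 1 := by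
    have one_div_le : 1 / ((m : ℝ) + 1) ≤ 1 := by
      simpa using Nat.one_div_le_one_div (α := ℝ) m.zero_le
    linarith [abs_sub_abs_le_abs_sub (g m n x) (f n x), abs_sub_comm (f n x) (g m n x),
      hg m n x, hC n x]
  have norm_sub_le (m n) : ‖X n - (M n).simpleIntegral (g m n)‖ ≤ 1 / ((m : ℝ) + 1) :=
    (M n).norm_sub_simpleIntegral_le (fun ψ => .of_bound (hf n).aestronglyMeasurable C
      (.of_forall (hC n))) (hX n) Nat.one_div_pos_of_nat.le (hg m n)
  have tendsto_map : Filter.Tendsto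
      (fun m => φ (tensorOp N H fun n => (M n).simpleIntegral (g m n))) .atTop
      (nhds (φ (tensorOp N H X))) := by
    simp only [← tensorOpL_apply]
    exact (φ.continuous.comp (tensorOpL N H).coe_continuous).continuousAt.tendsto.comp
      (tendsto_pi_nhds.mpr fun n => tendsto_of_norm_sub_le_one_div fun m => norm_sub_le m n)
  have tendsto_integral := tendsto_integral_prod (P := P) abs_g_le fun n x =>
    tendsto_of_norm_sub_le_one_div fun m => hg m n x
  simp only [map_tensorOp_simpleIntegral hP] at tendsto_map
  exact tendsto_nhds_unique tendsto_map
    ((Complex.continuous_ofReal.tendsto _).comp tendsto_integral)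

end Integration

theorem exists_hasTrace_bellOp_of_admitsLHV {n : ℕ} {H : Fin (n + 1) → HilbertSp.{u}}
    {ρ : (tensorSpace (n + 1) H).Op} (hρ : IsState ρ) {Λ : Fin (n + 1) → Fin 2 → Set ℝ}
    (hΛ : ∀ i s, Λ i s ⊆ Set.Icc (-1) 1) {M : (i : Fin (n + 1)) → (s : Fin 2) → POVM (Λ i s) (H i)}
    {P : (s : Fin (n + 1) → Fin 2) → Measure ((i : Fin (n + 1)) → Λ i (s i))}
    (hP : IsQuantumExperiment ρ (fun i s => Λ i s) M P)
    (hL : AdmitsLHV.{w} (fun i s => Λ i s) P) {X : (i : Fin (n + 1)) → Fin 2 → (H i).Op}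
    (hX : ∀ i s, (M i s).IsMean (X i s)) :
    ∃ z : ℂ, HasTrace (ρ ∘L bellOp (n + 1) H X) z ∧ ‖z‖ ≤ 2 ^ n := by
  obtain ⟨φ, hφ, -⟩ := hρ.exists_expectation
  have := hL.isProbabilityMeasure
  have map_tensorOp (s : Fin (n + 1) → Fin 2) :
      φ (tensorOp (n + 1) H fun i => X i (s i)) = (corr Λ P s : ℂ) :=
    map_tensorOp_eq_integral (fun A hA => (hφ _).unique (hP s A hA))
      (fun _ => measurable_subtype_coe) (fun i x => abs_le.mpr (hΛ i (s i) x.2))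
      fun i => hX i (s i)
  refine ⟨_, hφ _, ?_⟩
  rw [bellOp_eq_sum]
  simp only [map_sum, map_smul, map_tensorOp, smul_eq_mul, ← Complex.ofReal_mul,
    ← Complex.ofReal_sum, Complex.norm_real]
  exact abs_sum_mul_corr_le _ (fun _ => abs_linForm_bellCoeff_le n) hΛ hL

section FiniteEffects

open scoped ComplexOrder

theorem measureReal_sum_ofReal_smul {α ι : Type*} [MeasurableSpace α] [Fintype ι] {c : ι → ℝ}
    (hc : ∀ j, 0 ≤ c j) (μ : ι → Measure α) [∀ j, IsFiniteMeasure (μ j)] (A : Set α) :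
    (∑ j, ENNReal.ofReal (c j) • μ j).real A = ∑ j, c j * (μ j).real A := by
  simp only [measureReal_def, Measure.finsetSum_apply, Measure.smul_apply, smul_eq_mul]
  rw [ENNReal.toReal_sum fun j _ => ENNReal.mul_ne_top ENNReal.ofReal_ne_top (measure_ne_top _ _)]
  simp only [ENNReal.toReal_mul, ENNReal.toReal_ofReal (hc _)]

namespace POVM

variable {Λ ι : Type*} [MeasurableSpace Λ] [Fintype ι] {H : HilbertSp.{u}} (μ : ι → Measure Λ)
  [∀ j, IsProbabilityMeasure (μ j)] {E : ι → H.Op} (hE : ∀ j, (E j).IsPositive)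
  (hE1 : ∑ j, E j = 1)

/-- The measurement with finitely many effects `E j` whose outcome is drawn from `μ j` once the
effect `E j` has occurred; for Dirac measures `μ j` it is the measurement with finitely many
outcomes. -/
noncomputable def ofEffects : POVM Λ H where
  toFun A := ∑ j, ((μ j).real A : ℂ) • E j
  isPositive A _ := ContinuousLinearMap.isPositive_sum _ fun j _ =>
    (hE j).smul_of_nonneg (Complex.zero_le_real.mpr measureReal_nonneg)
  map_univ := by simpa only [probReal_univ, Complex.ofReal_one, one_smul] using hE1
  hasSum_iUnion A hA hd ψ := by
    simp only [FunLike.coe_sum, Finset.sum_apply, FunLike.coe_smul, Pi.smul_apply]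
    refine hasSum_sum fun j _ => HasSum.smul_const ?_ _
    refine Complex.hasSum_ofReal.mpr ?_
    have tsum_ne_top : ∑' k, μ j (A k) ≠ ⊤ := measure_iUnion hd hA ▸ measure_ne_top (μ j) _
    simpa only [measureReal_def, measure_iUnion hd hA, ENNReal.tsum_toReal_eq fun k =>
      measure_ne_top (μ j) (A k)] using (ENNReal.summable_toReal tsum_ne_top).hasSum

theorem measure_ofEffects (ψ : H) : (ofEffects μ hE hE1).measure ψ =
    ∑ j, ENNReal.ofReal (inner ℂ ψ (E j ψ)).re • μ j := by
  have weight_nonneg (j : ι) : 0 ≤ (inner ℂ ψ (E j ψ)).re := (hE j).re_inner_nonneg_right ψ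
  ext A hA
  rw [measure_apply _ _ hA, Measure.finsetSum_apply]
  simp only [ofEffects, FunLike.coe_sum, Finset.sum_apply, FunLike.coe_smul, Pi.smul_apply,
    inner_sum, inner_smul_right, Complex.re_sum, Complex.re_ofReal_mul, Measure.smul_apply,
    smul_eq_mul]
  rw [ENNReal.ofReal_sum_of_nonneg fun j _ => mul_nonneg measureReal_nonneg (weight_nonneg j)]
  refine Finset.sum_congr rfl fun j _ => ?_
  rw [ENNReal.ofReal_mul measureReal_nonneg, ofReal_measureReal, mul_comm]

theorem isMean_ofEffects {Λ : Set ℝ} {μ : ι → Measure Λ} [∀ j, IsProbabilityMeasure (μ j)]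
    (hμ : ∀ j, Integrable (fun x : Λ => (x : ℝ)) (μ j)) :
    (ofEffects μ hE hE1).IsMean (∑ j, ((∫ x, (x : ℝ) ∂(μ j) : ℝ) : ℂ) • E j) := by
  intro ψ
  rw [measure_ofEffects, integral_finsetSum_measure
    fun j _ => (hμ j).smul_measure ENNReal.ofReal_ne_top]
  simp only [integral_smul_measure, FunLike.coe_sum, Finset.sum_apply, FunLike.coe_smul,
    Pi.smul_apply, inner_sum, inner_smul_right, Complex.ofReal_sum, smul_eq_mul,
    Complex.ofReal_mul]
  refine Finset.sum_congr rfl fun j _ => ?_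
  have inner_nonneg : 0 ≤ inner ℂ ψ (E j ψ) := (hE j).inner_nonneg_right ψ
  rw [ENNReal.toReal_ofReal (Complex.nonneg_iff.mp inner_nonneg).1,
    ← Complex.eq_re_of_ofReal_le inner_nonneg, mul_comm]

end POVM

theorem exists_isProbabilityMeasure_map_tensorOp_ofEffects {N : ℕ} {H : Fin N → HilbertSp.{u}}
    {φ : (tensorSpace N H).Op →L[ℂ] ℂ} (hφ : ∀ T, T.IsPositive → 0 ≤ φ T) (hφ1 : φ 1 = 1)
    {Λ : Fin N → Type*} [∀ n, MeasurableSpace (Λ n)] {ι : Fin N → Type*} [∀ n, Fintype (ι n)]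
    (μ : (n : Fin N) → ι n → Measure (Λ n)) [∀ n j, IsProbabilityMeasure (μ n j)]
    {E : (n : Fin N) → ι n → (H n).Op} (hE : ∀ n j, (E n j).IsPositive)
    (hE1 : ∀ n, ∑ j, E n j = 1) :
    ∃ P : Measure ((n : Fin N) → Λ n), IsProbabilityMeasure P ∧
      ∀ A : (n : Fin N) → Set (Λ n),
        φ (tensorOp N H fun n => (POVM.ofEffects (μ n) (hE n) (hE1 n)).toFun (A n)) =
          (P.real (Set.univ.pi A) : ℂ) := by
  classical
  have weight_nonneg (r : (n : Fin N) → ι n) : 0 ≤ φ (tensorOp N H fun n => E n (r n)) :=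
    hφ _ (isPositive_tensorOp N H _ fun n => hE n (r n))
  let P : Measure ((n : Fin N) → Λ n) := ∑ r : (n : Fin N) → ι n,
    ENNReal.ofReal (φ (tensorOp N H fun n => E n (r n))).re • Measure.pi fun n => μ n (r n)
  have map_tensorOp (A : (n : Fin N) → Set (Λ n)) :
      φ (tensorOp N H fun n => (POVM.ofEffects (μ n) (hE n) (hE1 n)).toFun (A n)) =
        (P.real (Set.univ.pi A) : ℂ) := by
    rw [measureReal_sum_ofReal_smul fun r => (Complex.nonneg_iff.mp (weight_nonneg r)).1]
    simp only [POVM.ofEffects]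
    rw [← tensorOpL_apply, ContinuousMultilinearMap.map_sum, map_sum, Complex.ofReal_sum]
    refine Finset.sum_congr rfl fun r _ => ?_
    rw [ContinuousMultilinearMap.map_smul_univ, map_smul, tensorOpL_apply, Complex.ofReal_mul,
      ← Complex.eq_re_of_ofReal_le (weight_nonneg r), measureReal_def, Measure.pi_pi,
      ENNReal.toReal_prod, Complex.ofReal_prod, smul_eq_mul, mul_comm]
    rfl
  refine ⟨P, ⟨?_⟩, map_tensorOp⟩
  have measureReal_univ := map_tensorOp fun _ => Set.univ
  simp only [POVM.map_univ, tensorOp_one, hφ1, Set.pi_univ] at measureReal_univ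
  rw [← ENNReal.toReal_eq_one_iff]
  exact_mod_cast measureReal_univ.symm

theorem HilbertSp.isPositive_one_add {H : HilbertSp.{u}} {X : H.Op} (hX : IsSelfAdjoint X)
    (hX1 : ‖X‖ ≤ 1) : (1 + X).IsPositive := by
  rw [← ContinuousLinearMap.nonneg_iff_isPositive, ← neg_le_iff_add_nonneg']
  calc -1 ≤ -algebraMap ℝ H.Op ‖X‖ := by
        rw [neg_le_neg_iff, ← map_one (algebraMap ℝ H.Op)]
        exact algebraMap_mono H.Op hX1
    _ ≤ X := hX.neg_algebraMap_norm_le_self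

theorem HilbertSp.exists_effects_sub_eq {H : HilbertSp.{u}} {X : H.Op} (hX : IsSelfAdjoint X)
    (hX1 : ‖X‖ ≤ 1) :
    ∃ E : Fin 2 → H.Op, (∀ j, (E j).IsPositive) ∧ ∑ j, E j = 1 ∧ E 0 - E 1 = X := by
  have half_nonneg : (0 : ℂ) ≤ 1 / 2 := by norm_num [Complex.nonneg_iff]
  refine ⟨![(1 / 2 : ℂ) • (1 + X), (1 / 2 : ℂ) • (1 + -X)], Fin.forall_fin_two.mpr ⟨?_, ?_⟩, ?_, ?_⟩
  · exact (isPositive_one_add hX hX1).smul_of_nonneg half_nonneg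
  · exact (isPositive_one_add hX.neg ((norm_neg X).trans_le hX1)).smul_of_nonneg half_nonneg
  · rw [Fin.sum_univ_two]
    change (1 / 2 : ℂ) • (1 + X) + (1 / 2 : ℂ) • (1 + -X) = 1
    module
  · change (1 / 2 : ℂ) • (1 + X) - (1 / 2 : ℂ) • (1 + -X) = X
    module

end FiniteEffects

theorem exists_hasTrace_bellOp_of_stateAdmitsLHV {n : ℕ} {H : Fin (n + 1) → HilbertSp.{u}}
    {ρ : (tensorSpace (n + 1) H).Op} (hρ : IsState ρ) (hL : StateAdmitsLHV.{u, w} ρ)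
    {X : (i : Fin (n + 1)) → Fin 2 → (H i).Op} (hX : ∀ i s, IsSelfAdjoint (X i s))
    (hX1 : ∀ i s, ‖X i s‖ ≤ 1) :
    ∃ z : ℂ, HasTrace (ρ ∘L bellOp (n + 1) H X) z ∧ ‖z‖ ≤ 2 ^ n := by
  obtain ⟨φ, hφ, hφ_nonneg⟩ := hρ.exists_expectation
  choose E hE hE1 hEX using fun i s => HilbertSp.exists_effects_sub_eq (hX i s) (hX1 i s)
  let μ : Fin 2 → Measure (Set.Icc (-1 : ℝ) 1) :=
    fun j => Measure.dirac (![⟨1, by norm_num⟩, ⟨-1, by norm_num⟩] j)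
  choose P hP hPE using fun s : Fin (n + 1) → Fin 2 =>
    exists_isProbabilityMeasure_map_tensorOp_ofEffects hφ_nonneg ((hφ 1).unique hρ.2)
      (fun _ => μ) (fun i => hE i (s i)) (fun i => hE1 i (s i))
  have isQuantumExperiment : IsQuantumExperiment ρ (fun _ _ => Set.Icc (-1 : ℝ) 1)
      (fun i s => POVM.ofEffects μ (hE i s) (hE1 i s)) P := fun s A _ => hPE s A ▸ hφ _
  refine exists_hasTrace_bellOp_of_admitsLHV hρ (fun _ _ => subset_rfl) isQuantumExperiment
    (hL (fun _ _ => Set.Icc (-1 : ℝ) 1) _ P hP isQuantumExperiment) fun i s => ?_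
  convert POVM.isMean_ofEffects (hE i s) (hE1 i s) fun j => integrable_dirac (by simp) using 1
  rw [← hEX i s, Fin.sum_univ_two]
  simp [sub_eq_add_neg]

theorem mainTheorem6 (N : ℕ) (hN : 2 ≤ N) :
    -- the maximum over the vertices of the hypercube
    IsGreatest
      ((fun η : Fin N → Fin 2 → ℝ => |linForm (mkCoeff N) η|) ''
        {η | ∀ n s, η n s = -1 ∨ η n s = 1})
      ((2 : ℝ) ^ (N - 1)) ∧
    -- the inequality for every experiment with outcomes in `[-1, 1]` that admits an LHV model
    (∀ (Λ : Fin N → Fin 2 → Set ℝ) (_ : ∀ n s, Λ n s ⊆ Set.Icc (-1) 1)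
      (P : (s : Fin N → Fin 2) → Measure ((n : Fin N) → Λ n (s n)))
      (_ : ∀ s, IsProbabilityMeasure (P s)) (_ : AdmitsLHV.{w} (fun n s => Λ n s) P),
      |∑ s, mkCoeff N s * corr Λ P s| ≤ 2 ^ (N - 1)) ∧
    -- its tightness whenever the extremal values of the outcomes are `-1` and `1`
    (∀ (Λ : Fin N → Fin 2 → Set ℝ) (_ : ∀ n s, IsGLB (Λ n s) (-1))
      (_ : ∀ n s, IsLUB (Λ n s) 1),
      IsLUB
        {r : ℝ | ∃ P : (s : Fin N → Fin 2) → Measure ((n : Fin N) → Λ n (s n)),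
          (∀ s, IsProbabilityMeasure (P s)) ∧ AdmitsLHV.{w} (fun n s => Λ n s) P ∧
            r = |∑ s, mkCoeff N s * corr Λ P s|}
        (2 ^ (N - 1))) ∧
    -- the quantum inequality for an experiment on a state that admits an LHV model
    (∀ (H : Fin N → HilbertSp.{u}) (ρ : (tensorSpace N H).Op) (_ : IsState ρ)
      (Λ : Fin N → Fin 2 → Set ℝ) (_ : ∀ n s, Λ n s ⊆ Set.Icc (-1) 1)
      (M : (n : Fin N) → (s : Fin 2) → POVM (Λ n s) (H n))
      (P : (s : Fin N → Fin 2) → Measure ((n : Fin N) → Λ n (s n)))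
      (_ : ∀ s, IsProbabilityMeasure (P s)) (_ : IsQuantumExperiment ρ (fun n s => Λ n s) M P)
      (_ : AdmitsLHV.{w} (fun n s => Λ n s) P)
      (X : (n : Fin N) → Fin 2 → (H n).Op) (_ : ∀ n s, (M n s).IsMean (X n s)),
      ∃ z : ℂ, HasTrace (ρ ∘L bellOp N H X) z ∧ ‖z‖ ≤ 2 ^ (N - 1)) ∧
    -- the quantum inequality for arbitrary observables, on a state admitting the LHV description
    (∀ (H : Fin N → HilbertSp.{u}) (ρ : (tensorSpace N H).Op) (_ : IsState ρ)
      (_ : StateAdmitsLHV.{u, w} ρ)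
      (X : (n : Fin N) → Fin 2 → (H n).Op) (_ : ∀ n s, IsSelfAdjoint (X n s))
      (_ : ∀ n s, ‖X n s‖ ≤ 1),
      ∃ z : ℂ, HasTrace (ρ ∘L bellOp N H X) z ∧ ‖z‖ ≤ 2 ^ (N - 1)) := by
  obtain ⟨n, rfl⟩ : ∃ n, N = n + 2 := ⟨N - 2, by omega⟩
  rw [mkCoeff_eq_bellCoeff, Nat.add_sub_cancel (n + 1) 1]
  exact ⟨isGreatest_abs_linForm_bellCoeff (n + 1),
    fun Λ hΛ P _ hL => abs_sum_mul_corr_le _ (fun _ => abs_linForm_bellCoeff_le (n + 1)) hΛ hL,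
    fun Λ hglb hlub => isLUB_abs_sum_bellCoeff_mul_corr (n + 1) hglb hlub,
    fun H ρ hρ Λ hΛ M P _ hM hL X hX => exists_hasTrace_bellOp_of_admitsLHV hρ hΛ hM hL hX,
    fun H ρ hρ hL X hX hX1 => exists_hasTrace_bellOp_of_stateAdmitsLHV hρ hL hX hX1⟩
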